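/- Let $d\in\mathbb N$, $\alpha>0$, $T>0$. For $u\in L^2(\mathbb R^d)$ (complex-valued) let $(-\Delta)^{s}u$ be defined by the Fourier multiplier $|\xi|^{2s}$, let $H^\alpha(\mathbb R^d)=\{u\in L^2:(-\Delta)^{\alpha/2}u\in L^2\}$ with $\|u\|_{H^\alpha}=\|u\|_{L^2}+\|(-\Delta)^{\alpha/2}u\|_{L^2}$, and let $u_0\in H^\alpha(\mathbb R^d)$, $u_1\in L^2(\mathbb R^d)$. Consider the Cauchy problem $$u_{tt}+(-\Delta)^{\alpha}u+m(x)u=0\ \text{ on }[0,T]\times\mathbb R^d,\qquad u(0,\cdot)=u_0,\quad u_t(0,\cdot)=u_1, \tag{1}$$ whose possibly singular coefficient $m\ge 0$ is represented by regularisations, that is, by nets $(m_\varepsilon)_{\varepsilon\in(0,1]}$ of non-negative real-valued functions in $L^\infty(\mathbb R^d)$ (for instance mollifications of a non-negative distribution). A net $(m_\varepsilon)$ is called $L^\infty$-moderate if there are $N\in\mathbb N_0$, $c>0$ with $\|m_\varepsilon\|_{L^\infty}\le c\,\varepsilon^{-N}$ for all $\varepsilon\in(0,1]$. A net $(u_\varepsilon)_{\varepsilon\in(0,1]}$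 in $C([0,T];H^\alpha)\cap C^1([0,T];L^2)$ is called a very weak solution of (1) corresponding to the regularisation $(m_\varepsilon)$ if $(m_\varepsilon)$ is $L^\infty$-moderate; for every $\varepsilon\in(0,1]$, $u_\varepsilon$ solves (1) with $m_\varepsilon$ in place of $m$ (the equation being understood in $H^{-\alpha}$, i.e. tested against every function in $H^\alpha$, for each $t\in[0,T]$); and there are $N\in\mathbb N_0$, $c>0$ with $\sup_{t\in[0,T]}\big(\|u_\varepsilon(t)\|_{H^\alpha}+\|\partial_tu_\varepsilon(t)\|_{L^2}\big)\le c\,\varepsilon^{-N}$ for all $\varepsilon\in(0,1]$. **Theorem (uniqueness of the very weak solution).** Let $(m_\varepsilon)$ and $(\tilde m_\varepsilon)$ be non-negative regularisations such that for every integer $k>0$ there is $C_k$ with $\|m_\varepsilon-\tilde m_\varepsilon\|_{L^\infty}\le C_k\,\varepsilon^{k}$ for all $\varepsilon\in(0,1]$. Let $(u_\varepsilon)$ and $(\tilde u_\varepsilon)$ be very weak solutions of (1), with the same data $u_0,u_1$, corresponding to $(m_\varepsilon)$ and $(\tilde m_\varepsilon)$ respectively. Then for every $N\in\mathbb N_0$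 there is $C_N$ such that $$\|u_\varepsilon(t)-\tilde u_\varepsilon(t)\|_{L^2}\le C_N\,\varepsilon^{N}\qquad\text{for all }\varepsilon\in(0,1]\text{ and all }t\in[0,T].$$ -/

import Mathlib

open MeasureTheory Set
open scoped FourierTransform ENNReal InnerProductSpace

/-- The complex Hilbert space `L²(ℝᵈ)`. -/
abbrev L2 (d : ℕ) : Type := Lp ℂ 2 (volume : Measure (EuclideanSpace ℝ (Fin d)))

/-- The space `L^∞(ℝᵈ)` of real-valued functions, with the essential supremum norm
and the almost-everywhere order. -/
abbrev LInfty (d : ℕ) : Type := Lp ℝ ∞ (volume : Measure (EuclideanSpace ℝ (Fin d)))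

noncomputable section

/-- The Fourier transform of `(-Δ)^s u`, as a function of the frequency `ξ`. Since Mathlib's
Fourier transform has the kernel `e^{-2πi x·ξ}`, the symbol of `(-Δ)^s` is `(2π|ξ|)^{2s}`. -/
def fracLaplacianFourier {d : ℕ} (s : ℝ) (u : L2 d) (ξ : EuclideanSpace ℝ (Fin d)) : ℂ :=
  (((2 * Real.pi * ‖ξ‖) ^ (2 * s) : ℝ) : ℂ) * (𝓕 u : L2 d) ξ

/-- `(-Δ)^s u` belongs to `L²(ℝᵈ)`. -/
def FracLaplacianMemL2 {d : ℕ} (s : ℝ) (u : L2 d) : Prop :=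
  MemLp (fracLaplacianFourier s u) 2 (volume : Measure (EuclideanSpace ℝ (Fin d)))

open Classical in
/-- The fractional Laplacian `(-Δ)^s` on its domain `{u ∈ L² : (-Δ)^s u ∈ L²}`
(with the default value `0` outside of this domain). -/
def fracLaplacian {d : ℕ} (s : ℝ) (u : L2 d) : L2 d :=
  if h : FracLaplacianMemL2 s u then 𝓕⁻ (MemLp.toLp (fracLaplacianFourier s u) h) else 0

/-- `u ∈ H^α(ℝᵈ)`, that is, `u ∈ L²` and `(-Δ)^{α/2} u ∈ L²`. -/
def MemSobolevH {d : ℕ} (α : ℝ) (u : L2 d) : Prop :=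
  FracLaplacianMemL2 (α / 2) u

/-- The norm `‖u‖_{H^α} = ‖u‖_{L²} + ‖(-Δ)^{α/2} u‖_{L²}` of `u ∈ H^α(ℝᵈ)`. -/
def sobolevNorm {d : ℕ} (α : ℝ) (u : L2 d) : ℝ :=
  ‖u‖ + ‖fracLaplacian (α / 2) u‖

/-- The time derivative on `[0,T]` of an `L²`-valued function (one-sided at the end points). -/
def timeDeriv {d : ℕ} (T : ℝ) (u : ℝ → L2 d) (t : ℝ) : L2 d :=
  derivWithin u (Icc 0 T) t

/-- `u ∈ C([0,T]; H^α(ℝᵈ)) ∩ C¹([0,T]; L²(ℝᵈ))`. -/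
structure MemEnergySpace {d : ℕ} (α T : ℝ) (u : ℝ → L2 d) : Prop where
  mem_sobolev : ∀ t ∈ Icc 0 T, MemSobolevH α (u t)
  continuousOn : ContinuousOn u (Icc 0 T)
  continuousOn_fracLaplacian : ContinuousOn (fun t => fracLaplacian (α / 2) (u t)) (Icc 0 T)
  contDiffOn : ContDiffOn ℝ 1 u (Icc 0 T)

/-- `u ∈ C([0,T]; H^α) ∩ C¹([0,T]; L²)` solves the Cauchy problem
`u_tt + (-Δ)^α u + m u = 0` on `[0,T] × ℝᵈ`, `u(0) = u₀`, `u_t(0) = u₁`.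
As `(-Δ)^α u(t)` lies in the dual `H^{-α}` of `H^α` only, the equation is understood in `H^{-α}`:
it is tested against every `φ ∈ H^α`, with
`⟨φ, (-Δ)^α u⟩ = ⟨(-Δ)^{α/2} φ, (-Δ)^{α/2} u⟩`. -/
structure SolvesKleinGordon {d : ℕ} (α T : ℝ) (m : LInfty d) (u₀ u₁ : L2 d)
    (u : ℝ → L2 d) : Prop where
  mem_energySpace : MemEnergySpace α T u
  equation : ∀ φ : L2 d, MemSobolevH α φ → ∀ t ∈ Icc 0 T,
    HasDerivWithinAt (fun s => ⟪φ, timeDeriv T u s⟫_ℂ)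
      (-(⟪fracLaplacian (α / 2) φ, fracLaplacian (α / 2) (u t)⟫_ℂ
        + ⟪φ, (m • u t : L2 d)⟫_ℂ)) (Icc 0 T) t
  initial : u 0 = u₀
  initial_deriv : timeDeriv T u 0 = u₁

/-- `L^∞`-moderateness of a net `(g_ε)`, `ε ∈ (0,1]` (values at other `ε` are irrelevant). -/
def LInftyModerate {d : ℕ} (g : ℝ → LInfty d) : Prop :=
  ∃ (N : ℕ) (c : ℝ), 0 < c ∧ ∀ ε ∈ Ioc (0 : ℝ) 1, ‖g ε‖ ≤ c * (ε ^ N)⁻¹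

/-- `C¹`-moderateness of a net `(u_ε)`, `ε ∈ (0,1]`, in `C([0,T]; H^α) ∩ C¹([0,T]; L²)`:
`sup_{t ∈ [0,T]} (‖u_ε(t)‖_{H^α} + ‖∂ₜ u_ε(t)‖_{L²}) ≤ c ε^{-N}`. -/
def C1Moderate {d : ℕ} (α T : ℝ) (u : ℝ → ℝ → L2 d) : Prop :=
  ∃ (N : ℕ) (c : ℝ), 0 < c ∧ ∀ ε ∈ Ioc (0 : ℝ) 1, ∀ t ∈ Icc 0 T,
    sobolevNorm α (u ε t) + ‖timeDeriv T (u ε) t‖ ≤ c * (ε ^ N)⁻¹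

/-- The net `(u_ε)` is a very weak solution of the Cauchy problem for
`u_tt + (-Δ)^α u + m u = 0` with data `u₀, u₁`, corresponding to the regularisation `(m_ε)` of
the singular coefficient `m`: the regularisation is `L^∞`-moderate, `u_ε` solves the problem
with the coefficient `m_ε` for every `ε ∈ (0,1]`, and the net `(u_ε)` is `C¹`-moderate. -/
structure IsVeryWeakSolution {d : ℕ} (α T : ℝ) (m : ℝ → LInfty d) (u₀ u₁ : L2 d)
    (u : ℝ → ℝ → L2 d) : Prop where
  moderate_coeff : LInftyModerate m
  solves : ∀ ε ∈ Ioc (0 : ℝ) 1, SolvesKleinGordon α T (m ε) u₀ u₁ (u ε)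
  moderate : C1Moderate α T u

end

/-! ### Calculus on `Icc 0 T` and the abstract energy estimate. -/

section Abstract

variable {E : Type*} [NormedAddCommGroup E] [NormedSpace ℝ E]

/-! The difference w = u - u' solves w_tt + (-Δ)^α w + m w = (m' - m) u' with zero data. The usual
energy method tests with w_t, which is only in L² and so is not an admissible test function. Instead
the equation is integrated once in time and tested with w, which lies in H^α. With W and Z the
primitives of w and (-Δ)^{α/2} w, and F that of (m' - m) u', this gives d/dt (‖w‖² + ‖Z‖² + ⟨W, m
W⟩) = 2 Re ⟨w, F⟩, and m ≥ 0 makes the energy control ‖w‖².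

`norm_le_of_integrated_wave_equation` turns this into a bound linear in sup ‖F‖, and
`SolvesKleinGordon.norm_sub_le` applies it. The constant depends only on T, not on m, so
negligibility of m - m' beats the polynomial growth of u'. -/

theorem ContinuousOn.exists_primitive_Icc [CompleteSpace E] {T : ℝ} (hT : 0 < T) {f : ℝ → E}
    (hf : ContinuousOn f (Icc 0 T)) :
    ∃ F : ℝ → E, F 0 = 0 ∧ ∀ t ∈ Icc 0 T, HasDerivWithinAt F (f t) (Icc 0 T) t := by
  have hc : Continuous (IccExtend hT.le ((Icc 0 T).domRestrict f)) := hf.domRestrict.Icc_extend'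
  refine ⟨fun t => ∫ s in (0 : ℝ)..t, IccExtend hT.le ((Icc 0 T).domRestrict f) s, by simp, ?_⟩
  intro t ht
  have h := (intervalIntegral.integral_hasDerivAt_right (hc.intervalIntegrable 0 t)
    hc.stronglyMeasurable.stronglyMeasurableAtFilter hc.continuousAt).hasDerivWithinAt (s := Icc 0 T)
  rwa [IccExtend_of_mem _ _ ht] at h

theorem norm_le_of_hasDerivWithinAt_of_zero {T C : ℝ} {f f' : ℝ → E}
    (h0 : f 0 = 0) (hf : ∀ t ∈ Icc 0 T, HasDerivWithinAt f (f' t) (Icc 0 T) t)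
    (hC : ∀ t ∈ Icc 0 T, ‖f' t‖ ≤ C) {t : ℝ} (ht : t ∈ Icc 0 T) : ‖f t‖ ≤ C * t := by
  have h := (convex_Icc 0 T).norm_image_sub_le_of_norm_hasDerivWithin_le hf hC
    ⟨le_rfl, ht.1.trans ht.2⟩ ht
  simpa [h0, abs_of_nonneg ht.1] using h

theorem eq_of_hasDerivWithinAt_of_zero {T : ℝ} {f g f' : ℝ → E}
    (h0 : f 0 = g 0) (hf : ∀ t ∈ Icc 0 T, HasDerivWithinAt f (f' t) (Icc 0 T) t)
    (hg : ∀ t ∈ Icc 0 T, HasDerivWithinAt g (f' t) (Icc 0 T) t) {t : ℝ} (ht : t ∈ Icc 0 T) :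
    f t = g t := by
  have h := norm_le_of_hasDerivWithinAt_of_zero (f := fun t => f t - g t) (f' := fun _ => 0) (C := 0)
    (by simp [h0]) (fun t ht => ((hf t ht).sub (hg t ht)).congr_deriv (sub_self _)) (by simp) ht
  simpa [sub_eq_zero] using h

variable {H : Type*} [NormedAddCommGroup H] [InnerProductSpace ℂ H] [NormedSpace ℝ H]

theorem HasDerivWithinAt.re_inner {f g : ℝ → H} {f' g' : H} {s : Set ℝ} {t : ℝ}
    (hf : HasDerivWithinAt f f' s t) (hg : HasDerivWithinAt g g' s t) :
    HasDerivWithinAt (fun t => (⟪f t, g t⟫_ℂ).re) ((⟪f t, g'⟫_ℂ).re + (⟪f', g t⟫_ℂ).re) s t := by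
  exact (Complex.reCLM.hasFDerivAt.comp_hasDerivWithinAt t (hf.inner ℂ hg)).congr_deriv (by simp)

/-- Energy estimate for the second order equation `w_tt + A² w + P w = F_t` with zero data, integrated
once in time: `W`, `Z` are the primitives of `w`, `A w`, and the equation is tested with `w`. -/
theorem norm_le_of_integrated_wave_equation {T K : ℝ} (hT : 0 < T) (P : H →L[ℝ] H)
    (hPsymm : ∀ x y, ⟪P x, y⟫_ℂ = ⟪x, P y⟫_ℂ) (hPpos : ∀ x, 0 ≤ (⟪x, P x⟫_ℂ).re)
    {w w' a W Z F : ℝ → H} (hw0 : w 0 = 0) (hW0 : W 0 = 0) (hZ0 : Z 0 = 0)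
    (hw : ∀ t ∈ Icc 0 T, HasDerivWithinAt w (w' t) (Icc 0 T) t)
    (hW : ∀ t ∈ Icc 0 T, HasDerivWithinAt W (w t) (Icc 0 T) t)
    (hZ : ∀ t ∈ Icc 0 T, HasDerivWithinAt Z (a t) (Icc 0 T) t)
    (hF : ∀ t ∈ Icc 0 T, ‖F t‖ ≤ K)
    (heq : ∀ t ∈ Icc 0 T, ⟪w t, w' t⟫_ℂ = -(⟪a t, Z t⟫_ℂ + ⟪w t, P (W t)⟫_ℂ) + ⟪w t, F t⟫_ℂ)
    {t : ℝ} (ht : t ∈ Icc 0 T) : ‖w t‖ ≤ 2 * T * K := by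
  have hcont : ContinuousOn (fun t => ‖w t‖) (Icc 0 T) :=
    ContinuousOn.norm fun t ht => (hw t ht).continuousWithinAt
  -- Evaluating the energy at a maximum point of ‖w‖ lets one factor ‖w r‖ cancel, so no Gronwall
  -- argument is needed.
  obtain ⟨r, hr, hmax⟩ := isCompact_Icc.exists_isMaxOn ⟨t, ht⟩ hcont
  have hmax' : ∀ s ∈ Icc 0 T, ‖w s‖ ≤ ‖w r‖ := fun s hs => hmax hs
  have hK : 0 ≤ K := (norm_nonneg _).trans (hF t ht)
  have hG : ∀ s ∈ Icc 0 T, HasDerivWithinAt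
      (fun s => (⟪w s, w s⟫_ℂ).re + (⟪Z s, Z s⟫_ℂ).re + (⟪W s, P (W s)⟫_ℂ).re)
      (2 * (⟪w s, F s⟫_ℂ).re) (Icc 0 T) s := by
    intro s hs
    have h := (((hw s hs).re_inner (hw s hs)).add ((hZ s hs).re_inner (hZ s hs))).add
      ((hW s hs).re_inner (P.hasFDerivAt.comp_hasDerivWithinAt s (hW s hs)))
    refine h.congr_deriv ?_
    have e1 := congrArg Complex.re (heq s hs)
    have e2 : (⟪w' s, w s⟫_ℂ).re = (⟪w s, w' s⟫_ℂ).re := inner_re_symm (𝕜 := ℂ) _ _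
    have e3 : (⟪Z s, a s⟫_ℂ).re = (⟪a s, Z s⟫_ℂ).re := inner_re_symm (𝕜 := ℂ) _ _
    have e4 : (⟪W s, P (w s)⟫_ℂ).re = (⟪w s, P (W s)⟫_ℂ).re := by
      rw [← hPsymm]; exact inner_re_symm (𝕜 := ℂ) _ _
    simp only [Complex.add_re, Complex.neg_re, Function.comp_apply] at e1 ⊢
    linarith
  have hb := norm_le_of_hasDerivWithinAt_of_zero (C := 2 * (‖w r‖ * K)) (by simp [hw0, hW0, hZ0]) hG
    (fun s hs => by
      rw [norm_mul, Real.norm_two]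
      gcongr
      exact (Complex.abs_re_le_norm _).trans ((norm_inner_le_norm _ _).trans
        (mul_le_mul (hmax' s hs) (hF s hs) (norm_nonneg _) (norm_nonneg _)))) hr
  have h1 : (⟪w r, w r⟫_ℂ).re = ‖w r‖ ^ 2 := (norm_sq_eq_re_inner (𝕜 := ℂ) _).symm
  have h2 : 0 ≤ (⟪Z r, Z r⟫_ℂ).re := inner_self_nonneg (𝕜 := ℂ)
  have h3 := hPpos (W r)
  have h4 : ‖w r‖ ^ 2 ≤ ‖w r‖ * (2 * T * K) := by
    have h5 := (le_abs_self _).trans hb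
    have h6 : 2 * (‖w r‖ * K) * r ≤ 2 * (‖w r‖ * K) * T := by gcongr; exact hr.2
    simp only [h1] at h5
    linarith
  refine (hmax' t ht).trans ?_
  rcases (norm_nonneg (w r)).eq_or_lt with h | h
  · rw [← h]; positivity
  · rw [sq] at h4
    exact le_of_mul_le_mul_left h4 h

end Abstract

/-! ### Multiplication by a bounded function: symmetry and positivity. -/

section Multiplication

variable {d : ℕ}

theorem L2.smul_sub' (m : LInfty d) (x y : L2 d) :
    (m • (x - y) : L2 d) = (m • x : L2 d) - (m • y : L2 d) := by
  rw [sub_eq_add_neg, Lp.add_smul, Lp.smul_neg, ← sub_eq_add_neg]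

theorem L2.sub_smul' (m m' : LInfty d) (x : L2 d) :
    ((m - m') • x : L2 d) = (m • x : L2 d) - (m' • x : L2 d) := by
  rw [sub_eq_add_neg, Lp.smul_add, Lp.neg_smul, ← sub_eq_add_neg]

/-- Multiplication by a bounded real function as a bounded operator on `L²`. -/
noncomputable def LInfty.mulL2 (m : LInfty d) : L2 d →L[ℝ] L2 d :=
  LinearMap.mkContinuous
    { toFun := fun x => (m • x : L2 d)
      map_add' := fun x y => Lp.add_smul m x y
      map_smul' := fun c x => (Lp.smul_comm c m x).symm } ‖m‖
    fun x => Lp.norm_smul_le m x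

theorem LInfty.mulL2_apply (m : LInfty d) (x : L2 d) : m.mulL2 x = (m • x : L2 d) := rfl

theorem LInfty.inner_mulL2_left (m : LInfty d) (x y : L2 d) :
    ⟪m.mulL2 x, y⟫_ℂ = ⟪x, m.mulL2 y⟫_ℂ := by
  rw [L2.inner_def, L2.inner_def]
  refine integral_congr_ae ?_
  filter_upwards [Lp.coeFn_lpSMul (r := 2) m x, Lp.coeFn_lpSMul (r := 2) m y] with ξ h1 h2
  rw [LInfty.mulL2_apply, LInfty.mulL2_apply, h1, h2]
  simp only [Pi.smul_apply', RCLike.inner_apply, Complex.real_smul, map_mul, Complex.conj_ofReal]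
  ring

theorem LInfty.re_inner_mulL2_nonneg {m : LInfty d} (hm : 0 ≤ m) (x : L2 d) :
    0 ≤ (⟪x, m.mulL2 x⟫_ℂ).re := by
  have h : (⟪x, m.mulL2 x⟫_ℂ).re = ∫ ξ, (⟪x ξ, m.mulL2 x ξ⟫_ℂ).re := by
    rw [L2.inner_def]
    exact (integral_re (L2.integrable_inner (𝕜 := ℂ) x (m.mulL2 x))).symm
  rw [h]
  refine integral_nonneg_of_ae ?_
  filter_upwards [Lp.coeFn_lpSMul (r := 2) m x, (Lp.coeFn_nonneg m).2 hm] with ξ h1 h2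
  rw [LInfty.mulL2_apply, h1]
  have h3 : ⟪x ξ, (m ξ) • x ξ⟫_ℂ = ((m ξ * ‖x ξ‖ ^ 2 : ℝ) : ℂ) := by
    rw [RCLike.inner_apply, Complex.real_smul, mul_assoc, Complex.mul_conj']
    push_cast
    ring
  simp only [Pi.smul_apply', h3, Complex.ofReal_re, Pi.zero_apply] at h2 ⊢
  exact mul_nonneg h2 (by positivity)

end Multiplication

/-! ### Compatibility of the fractional Laplacian with differences. -/

section FractionalLaplacian

variable {d : ℕ} {s : ℝ} {u v : L2 d}

theorem fracLaplacianFourier_sub_ae (s : ℝ) (u v : L2 d) :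
    fracLaplacianFourier s (u - v) =ᵐ[volume] fracLaplacianFourier s u - fracLaplacianFourier s v := by
  have h : 𝓕 (u - v) = 𝓕 u - 𝓕 v := map_sub (FourierTransform.fourierₗ ℂ (L2 d)) u v
  filter_upwards [Lp.coeFn_sub (𝓕 u : L2 d) (𝓕 v)] with ξ hξ
  simp only [fracLaplacianFourier, Pi.sub_apply, h, hξ, mul_sub]

theorem FracLaplacianMemL2.sub (hu : FracLaplacianMemL2 s u) (hv : FracLaplacianMemL2 s v) :
    FracLaplacianMemL2 s (u - v) :=
  (memLp_congr_ae (fracLaplacianFourier_sub_ae s u v)).2 (MemLp.sub hu hv)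

theorem fracLaplacian_sub (hu : FracLaplacianMemL2 s u) (hv : FracLaplacianMemL2 s v) :
    fracLaplacian s (u - v) = fracLaplacian s u - fracLaplacian s v := by
  have h : MemLp.toLp (fracLaplacianFourier s (u - v)) (hu.sub hv)
      = MemLp.toLp (fracLaplacianFourier s u) hu - MemLp.toLp (fracLaplacianFourier s v) hv :=
    (MemLp.toLp_congr _ (MemLp.sub hu hv) (fracLaplacianFourier_sub_ae s u v)).trans
      (MemLp.toLp_sub hu hv)
  rw [fracLaplacian, fracLaplacian, fracLaplacian, dif_pos hu, dif_pos hv, dif_pos (hu.sub hv)]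
  exact (congrArg (FourierTransform.fourierInvₗ ℂ (L2 d)) h).trans (map_sub _ _ _)

end FractionalLaplacian

/-! ### Stability under perturbation of the coefficient. -/

section KleinGordon

variable {d : ℕ} {α T : ℝ} {u₀ u₁ : L2 d}

theorem MemEnergySpace.hasDerivWithinAt {u : ℝ → L2 d} (hu : MemEnergySpace α T u) {t : ℝ}
    (ht : t ∈ Icc 0 T) : HasDerivWithinAt u (timeDeriv T u t) (Icc 0 T) t :=
  (hu.contDiffOn.differentiableOn one_ne_zero t ht).hasDerivWithinAt

/-- Stability in `L²` of the Klein-Gordon equation under perturbation of the coefficient. -/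
theorem SolvesKleinGordon.norm_sub_le (hT : 0 < T) {m m' : LInfty d} (hm : 0 ≤ m)
    {u u' : ℝ → L2 d} (hu : SolvesKleinGordon α T m u₀ u₁ u)
    (hu' : SolvesKleinGordon α T m' u₀ u₁ u') {B : ℝ} (hB : ∀ t ∈ Icc 0 T, ‖u' t‖ ≤ B)
    {t : ℝ} (ht : t ∈ Icc 0 T) : ‖u t - u' t‖ ≤ 2 * T ^ 2 * (‖m - m'‖ * B) := by
  have hE := hu.mem_energySpace
  have hE' := hu'.mem_energySpace
  have hB0 : 0 ≤ B := (norm_nonneg _).trans (hB t ht)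
  obtain ⟨U, hU0, hU⟩ := hE.continuousOn.exists_primitive_Icc hT
  obtain ⟨U', hU'0, hU'⟩ := hE'.continuousOn.exists_primitive_Icc hT
  obtain ⟨Z, hZ0, hZ⟩ := hE.continuousOn_fracLaplacian.exists_primitive_Icc hT
  obtain ⟨Z', hZ'0, hZ'⟩ := hE'.continuousOn_fracLaplacian.exists_primitive_Icc hT
  -- The time-integrated weak equation: for fixed φ both sides vanish at 0 and have the same
  -- derivative. Using Z - Z' avoids showing that U - U' lies in H^α.
  have key : ∀ φ : L2 d, MemSobolevH α φ → ∀ t ∈ Icc 0 T,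
      ⟪φ, timeDeriv T u t - timeDeriv T u' t⟫_ℂ
        = -(⟪fracLaplacian (α / 2) φ, Z t - Z' t⟫_ℂ + ⟪φ, m.mulL2 (U t - U' t)⟫_ℂ)
          + ⟪φ, (m' - m).mulL2 (U' t)⟫_ℂ := by
    intro φ hφ t ht
    have hφ' : ∀ c t, HasDerivWithinAt (fun _ : ℝ => (c : L2 d)) 0 (Icc 0 T) t :=
      fun c t => hasDerivWithinAt_const _ _ _
    refine eq_of_hasDerivWithinAt_of_zero (T := T)
      (f := fun t => ⟪φ, timeDeriv T u t - timeDeriv T u' t⟫_ℂ)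
      (g := fun t => -(⟪fracLaplacian (α / 2) φ, Z t - Z' t⟫_ℂ + ⟪φ, m.mulL2 (U t - U' t)⟫_ℂ)
          + ⟪φ, (m' - m).mulL2 (U' t)⟫_ℂ) ?_ (fun t ht => ?_) (fun t ht => ?_) ht
      (f' := fun t => -(⟪fracLaplacian (α / 2) φ, fracLaplacian (α / 2) (u t)
          - fracLaplacian (α / 2) (u' t)⟫_ℂ + ⟪φ, m.mulL2 (u t - u' t)⟫_ℂ)
          + ⟪φ, (m' - m).mulL2 (u' t)⟫_ℂ)
    · simp [hu.initial_deriv, hu'.initial_deriv, hU0, hU'0, hZ0, hZ'0]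
    · have h := (hu.equation φ hφ t ht).sub (hu'.equation φ hφ t ht)
      simp only [inner_sub_right]
      refine h.congr_deriv ?_
      simp only [LInfty.mulL2_apply, L2.smul_sub', L2.sub_smul', inner_sub_right]
      ring
    · have h1 := (hφ' (fracLaplacian (α / 2) φ) t).inner ℂ ((hZ t ht).sub (hZ' t ht))
      have h2 := (hφ' φ t).inner ℂ
        (m.mulL2.hasFDerivAt.comp_hasDerivWithinAt t ((hU t ht).sub (hU' t ht)))
      have h3 := (hφ' φ t).inner ℂ
        ((m' - m).mulL2.hasFDerivAt.comp_hasDerivWithinAt t (hU' t ht))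
      exact ((h1.add h2).neg.add h3).congr_deriv (by simp)
  have hK : ∀ t ∈ Icc 0 T, ‖(m' - m).mulL2 (U' t)‖ ≤ ‖m - m'‖ * (B * T) := by
    intro t ht
    have h1 := norm_le_of_hasDerivWithinAt_of_zero hU'0 hU' hB ht
    rw [norm_sub_rev m m']
    refine (Lp.norm_smul_le _ _).trans ?_
    gcongr
    exact h1.trans (by gcongr; exact ht.2)
  have h := norm_le_of_integrated_wave_equation (w := fun t => u t - u' t)
    (w' := fun t => timeDeriv T u t - timeDeriv T u' t)
    (a := fun t => fracLaplacian (α / 2) (u t) - fracLaplacian (α / 2) (u' t))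
    (W := fun t => U t - U' t) (Z := fun t => Z t - Z' t) (F := fun t => (m' - m).mulL2 (U' t))
    hT m.mulL2 m.inner_mulL2_left (LInfty.re_inner_mulL2_nonneg hm)
    (by simp [hu.initial, hu'.initial]) (by simp [hU0, hU'0]) (by simp [hZ0, hZ'0])
    (fun t ht => (hE.hasDerivWithinAt ht).sub (hE'.hasDerivWithinAt ht))
    (fun t ht => (hU t ht).sub (hU' t ht)) (fun t ht => (hZ t ht).sub (hZ' t ht)) hK
    -- The test function is frozen at φ = u t - u' t, separately for each t.
    (fun t ht => by
      have h1 := hE.mem_sobolev t ht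
      have h2 := hE'.mem_sobolev t ht
      rw [← fracLaplacian_sub h1 h2]
      exact key _ (FracLaplacianMemL2.sub h1 h2) t ht) ht
  exact h.trans_eq (by ring)

end KleinGordon

theorem mainTheorem3 (d : ℕ) (α T : ℝ) (hα : 0 < α) (hT : 0 < T)
    (u₀ u₁ : L2 d) (hu₀ : MemSobolevH α u₀)
    (m m' : ℝ → LInfty d)
    (hm : ∀ ε ∈ Ioc (0 : ℝ) 1, 0 ≤ m ε) (hm' : ∀ ε ∈ Ioc (0 : ℝ) 1, 0 ≤ m' ε)
    (hmm' : ∀ k : ℕ, 0 < k → ∃ C : ℝ, ∀ ε ∈ Ioc (0 : ℝ) 1, ‖m ε - m' ε‖ ≤ C * ε ^ k)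
    (u u' : ℝ → ℝ → L2 d)
    (hu : IsVeryWeakSolution α T m u₀ u₁ u) (hu' : IsVeryWeakSolution α T m' u₀ u₁ u') :
    ∀ N : ℕ, ∃ C : ℝ, ∀ ε ∈ Ioc (0 : ℝ) 1, ∀ t ∈ Icc 0 T,
      ‖u ε t - u' ε t‖ ≤ C * ε ^ N := by
  intro N
  obtain ⟨M, c, hc, hmod⟩ := hu'.moderate
  -- M absorbs the growth ε^{-M} of u'; the extra 1 only makes the exponent positive.
  obtain ⟨C, hC⟩ := hmm' (N + M + 1) (Nat.succ_pos _)
  refine ⟨2 * T ^ 2 * (|C| * c), fun ε hε t ht => ?_⟩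
  have hε0 : 0 < ε := hε.1
  have hB : ∀ t ∈ Icc 0 T, ‖u' ε t‖ ≤ c * (ε ^ M)⁻¹ := fun t ht => by
    have h := hmod ε hε t ht
    unfold sobolevNorm at h
    linarith [norm_nonneg (fracLaplacian (α / 2) (u' ε t)), norm_nonneg (timeDeriv T (u' ε) t)]
  have hdiff : ‖m ε - m' ε‖ ≤ |C| * ε ^ (N + M) := by
    refine (hC ε hε).trans ?_
    have hpow : ε ^ (N + M + 1) ≤ ε ^ (N + M) :=
      pow_le_pow_of_le_one hε0.le hε.2 (Nat.le_succ _)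
    exact mul_le_mul (le_abs_self C) hpow (by positivity) (abs_nonneg C)
  calc ‖u ε t - u' ε t‖
      ≤ 2 * T ^ 2 * (‖m ε - m' ε‖ * (c * (ε ^ M)⁻¹)) :=
        (hu.solves ε hε).norm_sub_le hT (hm ε hε) (hu'.solves ε hε) hB ht
    _ ≤ 2 * T ^ 2 * (|C| * ε ^ (N + M) * (c * (ε ^ M)⁻¹)) := by gcongr
    _ = 2 * T ^ 2 * (|C| * c) * ε ^ N := by
        rw [pow_add]
        field_simp
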